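/- Let $q$ be a prime power and $1\le k<n$, $0\le c\le k-1$ integers. Let $\mathcal G_q(k,n)$ be the set of $k$-dimensional subspaces of $\mathbb F_q^n$. A subspace code is a subset $\mathcal C\subseteq\mathcal G_q(k,n)$ with $|\mathcal C|\ge 2$; with the distance $d(U,V)=\dim U+\dim V-2\dim(U\cap V)$ and the minimum distance $d(\mathcal C)=\min\{d(U,V): U,V\in\mathcal C,\ U\ne V\}$, it is called equidistant if $d(U,V)=d(\mathcal C)$ for all distinct $U,V\in\mathcal C$, and an equidistant code is $c$-intersecting if $d(\mathcal C)=2(k-c)$. Let $e_q(k,n,c)$ be the largest cardinality of an equidistant $c$-intersecting code in $\mathcal G_q(k,n)$. A code $\mathcal C$ is a sunflower if there is a subspace $Z\subseteq\mathbb F_q^n$ with $U\cap V=Z$ for all distinct $U,V\in\mathcal C$. The orthogonal code is $\mathcal C^\perp=\{U^\perp: U\in\mathcal C\}\subseteq\mathcal G_q(n-k,n)$, where $U^\perp$ is the orthogonal of $U$ for the standard inner product of $\mathbb F_q^n$. **Theorem.** For all integers $1\le k<n$ there is a number $q_0$, depending only on $k$ and $n$, such that the following holds for every prime power $q$ and every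 integer $0\le c\le k-1$. Let $\mathcal C\subseteq\mathcal G_q(k,n)$ be an equidistant $c$-intersecting code with $|\mathcal C|=e_q(k,n,c)$, and assume that one of the following conditions holds: - $c\in\{0,\,k-1,\,2k-n\}$ (with no condition on $q$); - $n\le (3k+1)/2$ and $q\ge q_0$; - $n\ge 3k+1$ and $q\ge q_0$. Then $\mathcal C$ is a sunflower or $\mathcal C^\perp$ is a sunflower. Moreover, the two alternatives are mutually exclusive unless $c=0$ and $n=2k$, in which case both hold. -/

import Mathlib

namespace SubspaceCodes

variable {F : Type*} [Field F] {n : ℕ}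

/-- The subspace distance `d(U,V) = dim U + dim V - 2 dim (U ∩ V)`.
The subtraction never truncates, because `dim (U ∩ V) ≤ dim U, dim V`. -/
noncomputable def subspaceDist (U V : Submodule F (Fin n → F)) : ℕ :=
  Module.finrank F U + Module.finrank F V - 2 * Module.finrank F ↥(U ⊓ V)

/-- `C` is a subspace code of constant dimension `k` in `F ^ n`: a set of `k`-dimensional
subspaces with at least two elements. -/
def IsSubspaceCode (k : ℕ) (C : Set (Submodule F (Fin n → F))) : Prop :=
  (∀ U ∈ C, Module.finrank F U = k) ∧ C.Nontrivial

/-- The minimum distance of a code (the set of distances is nonempty as soon as the code has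
two elements, and then the infimum in `ℕ` is a minimum). -/
noncomputable def minDist (C : Set (Submodule F (Fin n → F))) : ℕ :=
  sInf {d | ∃ U ∈ C, ∃ V ∈ C, U ≠ V ∧ subspaceDist U V = d}

/-- All pairs of distinct codewords are at distance equal to the minimum distance. -/
def IsEquidistant (C : Set (Submodule F (Fin n → F))) : Prop :=
  ∀ U ∈ C, ∀ V ∈ C, U ≠ V → subspaceDist U V = minDist C

/-- `C` is an equidistant `c`-intersecting subspace code of constant dimension `k`. -/
def IsEquidistantCode (k c : ℕ) (C : Set (Submodule F (Fin n → F))) : Prop :=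
  IsSubspaceCode k C ∧ IsEquidistant C ∧ (minDist C : ℤ) = 2 * ((k : ℤ) - c)

/-- The largest cardinality `e_q(k,n,c)` of an equidistant `c`-intersecting code of
`k`-dimensional subspaces of `F ^ n`, where `F` is the field with `q` elements. -/
noncomputable def maxCard (F : Type*) [Field F] (k n c : ℕ) : ℕ :=
  sSup {m | ∃ C : Set (Submodule F (Fin n → F)), IsEquidistantCode k c C ∧ C.ncard = m}

/-- An optimal equidistant `c`-intersecting code. -/
def IsOptimal (k c : ℕ) (C : Set (Submodule F (Fin n → F))) : Prop :=
  IsEquidistantCode k c C ∧ C.ncard = maxCard F k n c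

/-- A sunflower: a subspace code any two distinct codewords of which have the same
intersection `Z`, the center. -/
def IsSunflower (k : ℕ) (C : Set (Submodule F (Fin n → F))) : Prop :=
  IsSubspaceCode k C ∧
    ∃ Z : Submodule F (Fin n → F), ∀ U ∈ C, ∀ V ∈ C, U ≠ V → U ⊓ V = Z

/-- The orthogonal of a subspace for the standard inner product `∑ i, u i * v i` of `F ^ n`. -/
def orth (U : Submodule F (Fin n → F)) : Submodule F (Fin n → F) :=
  U.orthogonalBilin (dotProductBilin F F)

/-- The orthogonal code, consisting of the orthogonals of the codewords. -/
def orthCode (C : Set (Submodule F (Fin n → F))) : Set (Submodule F (Fin n → F)) :=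
  orth '' C

end SubspaceCodes

/-! Optimal codes are large, and large codes are sunflowers. Graphs of x ↦ a·x over an extension
field give codes of size q^(n-k), and duality gives size q^k (`exists_isIntersecting`,
`IsOptimal.pow_le_ncard`). In a code of size N, a variance estimate (`degree_variance`) shows that a
nonzero vector lies in at most 4q^(k-1) members or in all but that many. The popular vectors form a
subspace Z. Two members contain Z, so dim Z ≤ c; double counting inside a member A gives dim (Z ∩ A)
≥ c once N ≥ 17q^(2k-2). Hence Z is the center (`exists_center`). The two ranges of n are those
where this applies to the code or to its dual. The values c = 0 and c = 2k - n mean trivial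
intersections in the code or its dual; c = k - 1 is elementary (`center_or_common_sup`). If both
alternatives hold, the members are disjoint modulo Z in a space of dimension 2(k-c), so N ≤ q^(k-c)
+ 1; the lower bounds then force c = 0 and n = 2k. -/

namespace SubspaceCodes

open Module

/-! ### Degrees of vectors and the variance estimate -/

section Counting

open Classical

variable {F V : Type*} [Field F] [AddCommGroup V] [Module F V]

/-- The number of members of a family of subspaces that contain a given vector. -/
noncomputable def degree (S : Finset (Submodule F V)) (x : V) : ℕ :=
  (S.filter fun A => x ∈ A).card

lemma degree_le_card (S : Finset (Submodule F V)) (x : V) : degree S x ≤ S.card :=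
  Finset.card_filter_le _ _

lemma degree_zero (S : Finset (Submodule F V)) : degree S 0 = S.card := by
  simp [degree]

lemma degree_le_degree_smul (S : Finset (Submodule F V)) (a : F) (x : V) :
    degree S x ≤ degree S (a • x) :=
  Finset.card_le_card fun _ hA => by
    simp only [Finset.mem_filter] at hA ⊢
    exact ⟨hA.1, Submodule.smul_mem _ a hA.2⟩

lemma degree_add_degree_le (S : Finset (Submodule F V)) (x y : V) :
    degree S x + degree S y ≤ S.card + degree S (x + y) := by
  unfold degree
  rw [← Finset.card_union_add_card_inter]
  refine Nat.add_le_add (Finset.card_le_card ?_) (Finset.card_le_card ?_)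
  · exact Finset.union_subset (Finset.filter_subset _ _) (Finset.filter_subset _ _)
  · intro A hA
    simp only [Finset.mem_inter, Finset.mem_filter] at hA ⊢
    exact ⟨hA.1.1, A.add_mem hA.1.2 hA.2.2⟩

lemma sum_sq_weight [Fintype V] (S : Finset (Submodule F V)) (w : Submodule F V → ℤ) :
    ∑ y : V, (∑ A ∈ S, if y ∈ A then w A else 0) ^ 2 =
      ∑ A ∈ S, ∑ B ∈ S, w A * w B * (Nat.card ↥(A ⊓ B) : ℤ) := by
  have h : ∀ y : V, (∑ A ∈ S, if y ∈ A then w A else 0) ^ 2 =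
      ∑ A ∈ S, ∑ B ∈ S, if y ∈ A ⊓ B then w A * w B else 0 := by
    intro y
    rw [sq, Finset.sum_mul_sum]
    refine Finset.sum_congr rfl fun A _ => Finset.sum_congr rfl fun B _ => ?_
    by_cases hA : y ∈ A <;> by_cases hB : y ∈ B <;> simp [hA, hB]
  simp_rw [h]
  rw [Finset.sum_comm]
  refine Finset.sum_congr rfl fun A _ => ?_
  rw [Finset.sum_comm]
  refine Finset.sum_congr rfl fun B _ => ?_
  rw [← Finset.sum_filter, Finset.sum_const, nsmul_eq_mul, mul_comm, Nat.card_eq_fintype_card,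
    Fintype.card_subtype]

lemma sum_degree [Fintype V] (S : Finset (Submodule F V)) (A : Submodule F V) :
    ∑ y : V with y ∈ A, degree S y = ∑ B ∈ S, Nat.card ↥(A ⊓ B) := by
  unfold degree
  simp_rw [Finset.card_filter]
  rw [Finset.sum_comm]
  refine Finset.sum_congr rfl fun B _ => ?_
  rw [← Finset.card_filter, Finset.filter_filter, Nat.card_eq_fintype_card, Fintype.card_subtype]
  simp

/-- In a family with constant block size `K` and constant intersection size `L`, a vector is
either in few blocks or in almost all of them. -/
lemma degree_variance [Fintype F] [Fintype V] (S : Finset (Submodule F V)) (K L : ℕ)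
    (hK : ∀ A ∈ S, Nat.card A = K)
    (hL : ∀ A ∈ S, ∀ B ∈ S, A ≠ B → Nat.card ↥(A ⊓ B) = L) {x : V} (hx : x ≠ 0) :
    ((Fintype.card F : ℤ) - 1) * ((degree S x : ℤ) * (S.card - degree S x)) ≤ K * S.card := by
  set d : ℤ := (degree S x : ℤ) with hd
  set N : ℤ := (S.card : ℤ) with hN
  have hdN : 0 ≤ N - d := by
    have := degree_le_card S x
    omega
  have hd0 : 0 ≤ d := by omega
  have hN0 : 0 ≤ N := by omega
  -- These weights sum to zero, which removes the constant part L of the Gram matrix of the blocks.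
  let w : Submodule F V → ℤ := fun A => if x ∈ A then N - d else -d
  have hcard : ((S.filter fun A => x ∈ A).card : ℤ) = d := rfl
  have hcard' : ((S.filter fun A => x ∉ A).card : ℤ) = N - d := by
    have := Finset.card_filter_add_card_filter_not (s := S) (fun A => x ∈ A)
    omega
  have hw : ∑ A ∈ S, w A = 0 := by
    simp only [w, Finset.sum_ite, Finset.sum_const, nsmul_eq_mul, hcard, hcard']
    ring
  have hw2 : ∑ A ∈ S, w A ^ 2 = d * (N - d) * N := by
    simp only [w, apply_ite (fun z : ℤ => z ^ 2), Finset.sum_ite, Finset.sum_const, nsmul_eq_mul,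
      hcard, hcard']
    ring
  have hval : ∀ a : F, a ≠ 0 → (∑ A ∈ S, if a • x ∈ A then w A else 0) = d * (N - d) := by
    intro a ha
    have : ∀ A : Submodule F V, (if a • x ∈ A then w A else 0) = if x ∈ A then N - d else 0 := by
      intro A
      simp only [w, A.smul_mem_iff ha]
      split_ifs <;> rfl
    simp only [this, Finset.sum_ite, Finset.sum_const, nsmul_eq_mul, hcard]
    simp
  -- Only the q - 1 nonzero multiples of x are kept, each contributing the same square.
  have hlow : ((Fintype.card F : ℤ) - 1) * (d * (N - d)) ^ 2 ≤
      ∑ y : V, (∑ A ∈ S, if y ∈ A then w A else 0) ^ 2 := by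
    have hinj : Set.InjOn (fun a : F => a • x) (Finset.univ.filter fun a : F => a ≠ 0) :=
      fun a _ b _ h => smul_left_injective F hx h
    have h1 : ∑ y ∈ (Finset.univ.filter fun a : F => a ≠ 0).image (fun a : F => a • x),
        (∑ A ∈ S, if y ∈ A then w A else 0) ^ 2 =
          ((Fintype.card F : ℤ) - 1) * (d * (N - d)) ^ 2 := by
      rw [Finset.sum_image hinj, Finset.sum_congr rfl (g := fun _ => (d * (N - d)) ^ 2)]
      · rw [Finset.sum_const, nsmul_eq_mul, Finset.filter_ne', Finset.card_erase_of_mem (by simp),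
          Finset.card_univ, Nat.cast_sub Fintype.card_pos]
        simp
      · intro a ha
        rw [hval a (by simpa using ha)]
    rw [← h1]
    exact Finset.sum_le_sum_of_subset_of_nonneg (Finset.subset_univ _)
      fun _ _ _ => sq_nonneg _
  have hup : ∑ y : V, (∑ A ∈ S, if y ∈ A then w A else 0) ^ 2 =
      (K - L) * (d * (N - d) * N) := by
    rw [sum_sq_weight, ← hw2, Finset.mul_sum]
    refine Finset.sum_congr rfl fun A hA => ?_
    have : ∀ B ∈ S, w A * w B * (Nat.card ↥(A ⊓ B) : ℤ) =
        L * w A * w B + if A = B then (K - L) * w A ^ 2 else 0 := by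
      intro B hB
      split_ifs with h
      · subst h
        rw [inf_idem, hK A hA]
        ring
      · rw [hL A hA B hB h]
        ring
    rw [Finset.sum_congr rfl this, Finset.sum_add_distrib, ← Finset.mul_sum, hw]
    simp [hA]
  rcases (mul_nonneg hd0 hdN).eq_or_lt with h0 | hpos
  · rw [← h0, mul_zero]
    positivity
  · have h2 : ((Fintype.card F : ℤ) - 1) * (d * (N - d)) * (d * (N - d)) ≤
        (K * N) * (d * (N - d)) := by
      have : (0 : ℤ) ≤ L * (d * (N - d) * N) := by positivity
      nlinarith [hlow.trans_eq hup]
    exact le_of_mul_le_mul_right h2 hpos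

end Counting

/-- All members have dimension `k`, and distinct members meet in dimension `c`. -/
def IsIntersecting {F V : Type*} [Field F] [AddCommGroup V] [Module F V] (k c : ℕ)
    (C : Set (Submodule F V)) : Prop :=
  (∀ U ∈ C, finrank F U = k) ∧ ∀ U ∈ C, ∀ W ∈ C, U ≠ W → finrank F ↥(U ⊓ W) = c

/-! ### Large codes from an extension field -/

section Construction

variable {F : Type*} [Field F]

lemma exists_field_extension [Finite F] {m : ℕ} (hm : m ≠ 0) :
    ∃ (L : Type) (_ : Field L) (_ : Algebra F L), finrank F L = m ∧ FiniteDimensional F L ∧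
      Nat.card L = Nat.card F ^ m := by
  obtain ⟨p, hp⟩ := CharP.exists F
  have : Fact p.Prime := ⟨CharP.char_is_prime F p⟩
  have : NeZero m := ⟨hm⟩
  exact ⟨FiniteField.Extension F p m, inferInstance, inferInstance,
    FiniteField.finrank_extension F p m, inferInstance, FiniteField.natCard_extension F p m⟩

lemma finrank_graph {W L : Type*} [AddCommGroup W] [Module F W] [AddCommGroup L] [Module F L]
    (f : W →ₗ[F] L) : finrank F f.graph = finrank F W := by
  rw [LinearMap.graph_eq_range_prod]
  exact LinearMap.finrank_range_of_inj fun x y h => congrArg Prod.fst h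

lemma finrank_graph_inf_graph {W L : Type*} [AddCommGroup W] [Module F W] [AddCommGroup L]
    [Module F L] (f g : W →ₗ[F] L) :
    finrank F ↥(f.graph ⊓ g.graph) = finrank F (LinearMap.ker (f - g)) := by
  have h : f.graph ⊓ g.graph = (LinearMap.ker (f - g)).map (LinearMap.prod LinearMap.id f) := by
    ext ⟨x, y⟩
    simp only [Submodule.mem_inf, LinearMap.mem_graph_iff, Submodule.mem_map, LinearMap.mem_ker,
      LinearMap.sub_apply, sub_eq_zero]
    constructor
    · rintro ⟨rfl, h⟩
      exact ⟨x, h, rfl⟩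
    · rintro ⟨x', h, hx⟩
      cases hx
      exact ⟨rfl, h⟩
  rw [h]
  exact (Submodule.equivMapOfInjective _ (fun x y h => congrArg Prod.fst h) _).finrank_eq.symm

/-- A large sunflower, obtained from the graphs of the multiples of a linear map into an
extension field. -/
theorem exists_isIntersecting [Finite F] {n k c : ℕ} (hc : c < k) (hk : k < n)
    (h : 2 * k ≤ n + c) :
    ∃ C : Set (Submodule F (Fin n → F)), IsIntersecting k c C ∧
      C.ncard = Nat.card F ^ (n - k) := by
  obtain ⟨L, _, _, hL, _, hcard⟩ := exists_field_extension (F := F) (m := n - k) (by omega)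
  obtain ⟨i, hi⟩ : ∃ i : (Fin (k - c) → F) →ₗ[F] L, Function.Injective i :=
    finrank_le_iff_exists_linearMap.1 (by rw [hL, finrank_fin_fun]; omega)
  let W := (Fin c → F) × (Fin (k - c) → F)
  -- For a ≠ b the difference is (a - b)·i, so its kernel is exactly the factor of dimension c.
  let g : L → W →ₗ[F] L := fun a =>
    LinearMap.mulLeft F a ∘ₗ i ∘ₗ LinearMap.snd F (Fin c → F) (Fin (k - c) → F)
  have hker : ∀ a b, a ≠ b → finrank F (LinearMap.ker (g a - g b)) = c := by
    intro a b hab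
    have : LinearMap.ker (g a - g b) =
        LinearMap.range (LinearMap.inl F (Fin c → F) (Fin (k - c) → F)) := by
      rw [LinearMap.range_inl]
      ext x
      simp only [g, LinearMap.mem_ker, LinearMap.sub_apply, LinearMap.comp_apply,
        LinearMap.mulLeft_apply, ← sub_mul, mul_eq_zero, sub_eq_zero, hab, false_or,
        map_eq_zero_iff i hi]
    rw [this, LinearMap.finrank_range_of_inj LinearMap.inl_injective, finrank_fin_fun]
  have hW : finrank F W = k := by
    simp only [W, finrank_prod, finrank_fin_fun]
    omega
  obtain ⟨e⟩ : Nonempty ((W × L) ≃ₗ[F] (Fin n → F)) :=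
    FiniteDimensional.nonempty_linearEquiv_of_finrank_eq (by
      rw [finrank_prod, hW, hL, finrank_fin_fun]
      omega)
  let G : L → Submodule F (Fin n → F) := fun a => (g a).graph.map (e : W × L →ₗ[F] Fin n → F)
  have hG : ∀ a, finrank F (G a) = k := fun a => by
    rw [← hW, ← finrank_graph (g a)]
    exact e.finrank_map_eq _
  have hGG : ∀ a b, a ≠ b → finrank F ↥(G a ⊓ G b) = c := fun a b hab => by
    rw [← hker a b hab, ← finrank_graph_inf_graph, ← Submodule.map_inf _ e.injective]
    exact e.finrank_map_eq _
  have hinj : Function.Injective G := by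
    intro a b hab
    by_contra hne
    have h1 := hGG a b hne
    rw [← hab, inf_idem, hG] at h1
    omega
  refine ⟨Set.range G, ⟨?_, ?_⟩, ?_⟩
  · rintro _ ⟨a, rfl⟩
    exact hG a
  · rintro _ ⟨a, rfl⟩ _ ⟨b, rfl⟩ hab
    exact hGG a b fun h => hab (congrArg G h)
  · rw [← hcard, ← Set.image_univ, Set.ncard_image_of_injective _ hinj, Set.ncard_univ]

end Construction

/-! ### The center of a large family -/

section Center

open Classical

variable {F V : Type*} [Field F] [Fintype F] [AddCommGroup V] [Module F V] [Fintype V]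

lemma natCard_submodule (A : Submodule F V) : Nat.card A = Fintype.card F ^ finrank F A := by
  rw [Module.natCard_eq_pow_finrank (K := F), Nat.card_eq_fintype_card]

/-- Since q - 1 ≥ q/2, one factor q cancels from q^k at the cost of a factor 2. -/
lemma degree_mul_le {S : Finset (Submodule F V)} {k c : ℕ} (hk : 1 ≤ k)
    (hS : IsIntersecting k c (S : Set (Submodule F V))) {x : V} (hx : x ≠ 0) :
    degree S x * (S.card - degree S x) ≤ 2 * Fintype.card F ^ (k - 1) * S.card := by
  have hq : 2 ≤ Fintype.card F := Fintype.one_lt_card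
  obtain ⟨m, rfl⟩ : ∃ m, k = m + 1 := ⟨k - 1, by omega⟩
  have h := degree_variance S (Fintype.card F ^ (m + 1)) (Fintype.card F ^ c)
    (fun A hA => by rw [natCard_submodule, hS.1 A hA])
    (fun A hA B hB hAB => by rw [natCard_submodule, hS.2 A hA B hB hAB]) hx
  have hd := degree_le_card S x
  zify [hd] at hq ⊢
  push_cast at h
  simp only [Nat.add_sub_cancel]
  set q : ℤ := (Fintype.card F : ℤ)
  have h0 : (0 : ℤ) ≤ (degree S x : ℤ) * (S.card - degree S x) :=
    mul_nonneg (by positivity) (by omega)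
  have h1 : q * ((degree S x : ℤ) * (S.card - degree S x)) ≤ q * (2 * q ^ m * S.card) := by
    rw [pow_succ] at h
    nlinarith
  exact le_of_mul_le_mul_left h1 (by omega)

/-- The larger of d and N - d is at least N/2, so `degree_mul_le` bounds the smaller one. -/
lemma degree_dichotomy {S : Finset (Submodule F V)} {k c : ℕ} (hk : 1 ≤ k)
    (hS : IsIntersecting k c (S : Set (Submodule F V))) {x : V} (hx : x ≠ 0) :
    (2 * degree S x ≤ S.card → degree S x ≤ 4 * Fintype.card F ^ (k - 1)) ∧
    (S.card < 2 * degree S x → S.card ≤ degree S x + 4 * Fintype.card F ^ (k - 1)) := by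
  have h := degree_mul_le hk hS hx
  have hd := degree_le_card S x
  obtain ⟨e, he⟩ := Nat.exists_eq_add_of_le hd
  rw [he, Nat.add_sub_cancel_left] at h
  rw [he]
  generalize Fintype.card F ^ (k - 1) = M at *
  generalize degree S x = d at *
  constructor
  · intro h1
    have hde : d ≤ e := by omega
    rcases e.eq_zero_or_pos with rfl | hpos
    · omega
    · refine le_of_mul_le_mul_right (a := e) ?_ hpos
      nlinarith
  · intro h1
    have hde : e ≤ d := by omega
    have hpos : 0 < d := by omega
    have : e ≤ 4 * M := by
      refine le_of_mul_le_mul_left (a := d) ?_ hpos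
      nlinarith
    omega

/-- The vectors contained in more than half of the members of a large family form a subspace. -/
lemma exists_submodule_degree {S : Finset (Submodule F V)} {k c : ℕ} (hk : 1 ≤ k)
    (hS : IsIntersecting k c (S : Set (Submodule F V)))
    (hcard : 16 * Fintype.card F ^ (k - 1) < S.card) :
    ∃ Z : Submodule F V, (∀ x ∈ Z, S.card ≤ degree S x + 4 * Fintype.card F ^ (k - 1)) ∧
      ∀ x ∉ Z, degree S x ≤ 4 * Fintype.card F ^ (k - 1) := by
  have hbig : ∀ x : V, S.card < 2 * degree S x →
      S.card ≤ degree S x + 4 * Fintype.card F ^ (k - 1) := by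
    intro x h
    by_cases hx : x = 0
    · rw [hx, degree_zero]
      omega
    · exact (degree_dichotomy hk hS hx).2 h
  let Z : Submodule F V :=
    { carrier := {x | S.card < 2 * degree S x}
      zero_mem' := by
        rw [Set.mem_ofPred_eq, degree_zero]
        omega
      -- With M = q^(k-1), the sum has degree at least N - 8M, which exceeds N/2 because N > 16M.
      add_mem' := by
        intro x y hx hy
        have hx' := hbig x hx
        have hy' := hbig y hy
        have := degree_add_degree_le S x y
        rw [Set.mem_ofPred_eq]
        omega
      smul_mem' := by
        intro a x hx
        have := degree_le_degree_smul S a x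
        rw [Set.mem_ofPred_eq] at hx ⊢
        omega }
  refine ⟨Z, hbig, fun x hx => ?_⟩
  have hx' : ¬ S.card < 2 * degree S x := hx
  by_cases h0 : x = 0
  · exact absurd (h0 ▸ Z.zero_mem) hx
  · exact (degree_dichotomy hk hS h0).1 (by omega)

lemma two_mul_card_inf_le {A Z : Submodule F V} (h : ¬ Z ≤ A) :
    2 * Nat.card ↥(Z ⊓ A) ≤ Nat.card Z := by
  rw [natCard_submodule, natCard_submodule]
  have hlt : finrank F ↥(Z ⊓ A) < finrank F Z :=
    Submodule.finrank_lt_finrank_of_lt (inf_le_left.lt_of_ne fun h' => h (inf_eq_left.1 h'))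
  calc 2 * Fintype.card F ^ finrank F ↥(Z ⊓ A)
      ≤ Fintype.card F * Fintype.card F ^ finrank F ↥(Z ⊓ A) :=
        Nat.mul_le_mul_right _ Fintype.one_lt_card
    _ = Fintype.card F ^ (finrank F ↥(Z ⊓ A) + 1) := by ring
    _ ≤ _ := Nat.pow_le_pow_right Fintype.card_pos hlt

/-- Two members contain every subspace all of whose vectors have large degree. -/
lemma exists_pair_ge_of_degree {S : Finset (Submodule F V)} {M : ℕ} {Z : Submodule F V}
    (hZ : ∀ x ∈ Z, S.card ≤ degree S x + M) (hcard : 2 * M + 2 ≤ S.card) :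
    ∃ A ∈ S, ∃ B ∈ S, A ≠ B ∧ Z ≤ A ∧ Z ≤ B := by
  have hsum := sum_degree S Z
  have hlow : Nat.card Z * S.card ≤ (∑ y : V with y ∈ Z, degree S y) + Nat.card Z * M := by
    have hcZ : (Finset.univ.filter fun y : V => y ∈ Z).card = Nat.card Z := by
      rw [Nat.card_eq_fintype_card, Fintype.card_subtype]
    rw [← hcZ, ← smul_eq_mul, ← smul_eq_mul, ← Finset.sum_const, ← Finset.sum_const,
      ← Finset.sum_add_distrib]
    exact Finset.sum_le_sum fun y hy => hZ y (Finset.mem_filter.1 hy).2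
  have hup : 2 * ∑ B ∈ S, Nat.card ↥(Z ⊓ B) ≤
      (S.filter fun B => Z ≤ B).card * Nat.card Z + S.card * Nat.card Z := by
    rw [Finset.card_filter, Finset.sum_mul, ← smul_eq_mul S.card, ← Finset.sum_const,
      ← Finset.sum_add_distrib, Finset.mul_sum]
    refine Finset.sum_le_sum fun B _ => ?_
    split_ifs with h
    · rw [inf_eq_left.2 h]
      omega
    · have := two_mul_card_inf_le h
      omega
  have hpos : 0 < Nat.card Z := Nat.card_pos
  -- If m members contain Z, the others meet it in at most half: |Z|(N - M) ≤ |Z|(m + N)/2.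
  have hm : S.card ≤ (S.filter fun B => Z ≤ B).card + 2 * M := by
    refine le_of_mul_le_mul_right (a := Nat.card Z) ?_ hpos
    rw [← hsum] at hup
    nlinarith
  obtain ⟨A, hA, B, hB, hAB⟩ := Finset.one_lt_card.1
    (show 1 < (S.filter fun B => Z ≤ B).card by omega)
  rw [Finset.mem_filter] at hA hB
  exact ⟨A, hA.1, B, hB.1, hAB, hA.2, hB.2⟩

/-- The degrees over A sum to q^k + (N-1)q^c. Vectors outside Z contribute at most 4q^(2k-1); if dim
(Z ∩ A) < c, those in Z add at most N·q^(c-1), which is too little. -/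
lemma le_finrank_inf_of_degree {S : Finset (Submodule F V)} {k c : ℕ} (hc : 1 ≤ c) (hk : c < k)
    (hS : IsIntersecting k c (S : Set (Submodule F V)))
    (hcard : 17 * Fintype.card F ^ (2 * k - 2) ≤ S.card) {Z : Submodule F V}
    (hZ : ∀ x ∉ Z, degree S x ≤ 4 * Fintype.card F ^ (k - 1)) {A : Submodule F V} (hA : A ∈ S) :
    c ≤ finrank F ↥(Z ⊓ A) := by
  by_contra! hlt
  set q := Fintype.card F with hq
  have hq2 : 2 ≤ q := Fintype.one_lt_card
  have hAk : Nat.card A = q ^ k := by rw [natCard_submodule, hS.1 A hA]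
  have hsum : ∑ y : V with y ∈ A, degree S y = q ^ k + (S.card - 1) * q ^ c := by
    rw [sum_degree, ← Finset.add_sum_erase _ _ hA, inf_idem, hAk,
      Finset.sum_congr rfl (g := fun _ => q ^ c), Finset.sum_const, Finset.card_erase_of_mem hA,
      smul_eq_mul]
    intro B hB
    rw [Finset.mem_erase] at hB
    rw [natCard_submodule, hS.2 A hA B hB.2 hB.1.symm]
  have hup : ∑ y : V with y ∈ A, degree S y ≤
      Nat.card ↥(Z ⊓ A) * S.card + q ^ k * (4 * q ^ (k - 1)) := by
    have hcA : (Finset.univ.filter fun y : V => y ∈ A).card = q ^ k := by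
      rw [← hAk, Nat.card_eq_fintype_card, Fintype.card_subtype]
    have hcZA : ((Finset.univ.filter fun y : V => y ∈ A).filter fun y => y ∈ Z).card =
        Nat.card ↥(Z ⊓ A) := by
      rw [Nat.card_eq_fintype_card, Fintype.card_subtype, Finset.filter_filter]
      congr 1
      ext y
      simp [and_comm]
    rw [← hcA, ← hcZA, Finset.card_filter, Finset.sum_mul, ← smul_eq_mul (_ : ℕ) (4 * _),
      ← Finset.sum_const, ← Finset.sum_add_distrib]
    refine Finset.sum_le_sum fun y _ => ?_
    split_ifs with h
    · have := degree_le_card S y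
      omega
    · have := hZ y h
      omega
  have hb : q * Nat.card ↥(Z ⊓ A) ≤ q ^ c := by
    rw [natCard_submodule, ← hq, ← pow_succ']
    exact Nat.pow_le_pow_right (by omega) hlt
  obtain ⟨m, rfl⟩ : ∃ m, k = m + 1 := ⟨k - 1, by omega⟩
  obtain ⟨e, rfl⟩ : ∃ e, c = e + 1 := ⟨c - 1, by omega⟩
  have h1 : 2 * (m + 1) - 2 = m + m := by omega
  rw [h1, pow_add] at hcard
  rw [hsum] at hup
  simp only [Nat.add_sub_cancel] at hup
  obtain ⟨N, hN⟩ : ∃ N, S.card = N + 1 := ⟨S.card - 1, by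
    have : 0 < q ^ m * q ^ m := by positivity
    omega⟩
  rw [hN] at hup hcard
  simp only [Nat.add_sub_cancel, pow_succ] at hup hb
  have hqe : 1 ≤ q ^ e := Nat.one_le_pow _ _ (by omega)
  have hqm : 1 ≤ q ^ m := Nat.one_le_pow _ _ (by omega)
  generalize Nat.card ↥(Z ⊓ A) = b at *
  generalize q ^ e = x at *
  generalize q ^ m = y at *
  have hb' : b ≤ x := le_of_mul_le_mul_left (by linarith) (show 0 < q by omega)
  have h2 : b * (N + 1) ≤ x * (N + 1) := Nat.mul_le_mul_right _ hb'
  have h3 : x * N * 2 ≤ x * N * q := Nat.mul_le_mul_left _ hq2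
  have h4 : x * 2 ≤ x * q := Nat.mul_le_mul_left _ hq2
  -- Half of xNq absorbs the term xN coming from Z ∩ A, which doubles 4 to 8.
  have h5 : x * N ≤ x + 8 * (y * y) := by
    refine le_of_mul_le_mul_left (a := q) ?_ (by omega)
    nlinarith
  have h6 : N ≤ 1 + 8 * (y * y) := by
    refine le_of_mul_le_mul_left (a := x) ?_ hqe
    nlinarith
  have h7 : 1 ≤ y * y := Nat.mul_pos hqm hqm
  omega

/-- A large family of `k`-dimensional subspaces pairwise meeting in dimension `c` is a
sunflower. -/
theorem exists_center {S : Finset (Submodule F V)} {k c : ℕ} (hc : 1 ≤ c) (hk : c < k)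
    (hS : IsIntersecting k c (S : Set (Submodule F V)))
    (hcard : 17 * Fintype.card F ^ (2 * k - 2) ≤ S.card) :
    ∃ Z : Submodule F V, ∀ U ∈ S, ∀ W ∈ S, U ≠ W → U ⊓ W = Z := by
  have hq2 : 2 ≤ Fintype.card F := Fintype.one_lt_card
  have h1 : 2 * Fintype.card F ^ (k - 1) ≤ Fintype.card F ^ (2 * k - 2) :=
    calc 2 * Fintype.card F ^ (k - 1) ≤ Fintype.card F * Fintype.card F ^ (k - 1) :=
          Nat.mul_le_mul_right _ hq2
      _ = Fintype.card F ^ (k - 1 + 1) := by ring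
      _ ≤ _ := Nat.pow_le_pow_right (by omega) (by omega)
  have h2 : 1 ≤ Fintype.card F ^ (k - 1) := Nat.one_le_pow _ _ (by omega)
  obtain ⟨Z, hZ, hZ'⟩ := exists_submodule_degree (by omega) hS (by omega)
  obtain ⟨A, hA, B, hB, hAB, hZA, hZB⟩ := exists_pair_ge_of_degree hZ (by omega)
  have hZc : finrank F Z ≤ c := by
    rw [← hS.2 A hA B hB hAB]
    exact Submodule.finrank_mono (le_inf hZA hZB)
  have hle : ∀ U ∈ S, Z ≤ U := fun U hU => by
    have := le_finrank_inf_of_degree hc hk hS hcard hZ' hU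
    exact inf_eq_left.1 (Submodule.eq_of_le_of_finrank_le inf_le_left (by omega))
  have hcZ : c ≤ finrank F Z :=
    (le_finrank_inf_of_degree hc hk hS hcard hZ' hA).trans (Submodule.finrank_mono inf_le_left)
  refine ⟨Z, fun U hU W hW hUW => ?_⟩
  refine (Submodule.eq_of_le_of_finrank_le (le_inf (hle U hU) (hle W hW)) ?_).symm
  rw [hS.2 U hU W hW hUW]
  exact hcZ

end Center

/-! ### Duality -/

section Orthogonal

variable {F : Type*} [Field F] {n : ℕ}

lemma nondegenerate_dotProductBilin :
    LinearMap.BilinForm.Nondegenerate (dotProductBilin F F : LinearMap.BilinForm F (Fin n → F)) := by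
  refine ⟨fun x h => dotProduct_eq_zero x h, fun x h => dotProduct_eq_zero x fun w => ?_⟩
  rw [dotProduct_comm]
  exact h w

lemma isRefl_dotProductBilin :
    LinearMap.BilinForm.IsRefl (dotProductBilin F F : LinearMap.BilinForm F (Fin n → F)) :=
  fun x y h => (dotProduct_comm y x).trans h

lemma finrank_orth (U : Submodule F (Fin n → F)) : finrank F (orth U) = n - finrank F U := by
  have := LinearMap.BilinForm.finrank_orthogonal (nondegenerate_dotProductBilin (F := F) (n := n)) U
  rwa [finrank_fin_fun] at this

lemma orth_orth (U : Submodule F (Fin n → F)) : orth (orth U) = U :=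
  LinearMap.BilinForm.orthogonal_orthogonal nondegenerate_dotProductBilin
    isRefl_dotProductBilin U

lemma orth_injective : Function.Injective (orth : Submodule F (Fin n → F) → _) :=
  Function.LeftInverse.injective orth_orth

lemma orth_le_orth {U W : Submodule F (Fin n → F)} (h : U ≤ W) : orth W ≤ orth U :=
  Submodule.orthogonalBilin_le h

lemma orth_sup (U W : Submodule F (Fin n → F)) : orth (U ⊔ W) = orth U ⊓ orth W := by
  refine le_antisymm (le_inf (orth_le_orth le_sup_left) (orth_le_orth le_sup_right)) ?_
  have h : U ⊔ W ≤ orth (orth U ⊓ orth W) := by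
    refine sup_le ?_ ?_
    · exact (orth_orth U).ge.trans (orth_le_orth inf_le_left)
    · exact (orth_orth W).ge.trans (orth_le_orth inf_le_right)
  exact (orth_orth _).ge.trans (orth_le_orth h)

lemma ncard_orthCode (C : Set (Submodule F (Fin n → F))) : (orthCode C).ncard = C.ncard :=
  Set.ncard_image_of_injective _ orth_injective

lemma IsIntersecting.finrank_sup {C : Set (Submodule F (Fin n → F))} {k c : ℕ}
    (hC : IsIntersecting k c C) {U W : Submodule F (Fin n → F)} (hU : U ∈ C) (hW : W ∈ C)
    (h : U ≠ W) : finrank F ↥(U ⊔ W) + c = 2 * k := by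
  have := Submodule.finrank_sup_add_finrank_inf_eq U W
  rw [hC.2 U hU W hW h, hC.1 U hU, hC.1 W hW] at this
  omega

lemma IsIntersecting.orthCode {C : Set (Submodule F (Fin n → F))} {k c : ℕ}
    (hC : IsIntersecting k c C) : IsIntersecting (n - k) (n + c - 2 * k) (orthCode C) := by
  refine ⟨?_, ?_⟩
  · rintro _ ⟨U, hU, rfl⟩
    rw [finrank_orth, hC.1 U hU]
  · rintro _ ⟨U, hU, rfl⟩ _ ⟨W, hW, rfl⟩ h
    have := hC.finrank_sup hU hW fun h' => h (congrArg orth h')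
    rw [← orth_sup, finrank_orth]
    omega

lemma IsIntersecting.le_of_nontrivial {C : Set (Submodule F (Fin n → F))} {k c : ℕ}
    (hC : IsIntersecting k c C) (h : C.Nontrivial) : 2 * k ≤ n + c := by
  obtain ⟨U, hU, W, hW, hUW⟩ := h
  have h1 := hC.finrank_sup hU hW hUW
  have h2 := Submodule.finrank_le (U ⊔ W)
  rw [finrank_fin_fun] at h2
  omega

end Orthogonal

/-! ### Lower bounds for optimal codes -/

section Optimal

variable {F : Type*} [Field F] {n : ℕ}

lemma isEquidistantCode_iff {k c : ℕ} (hc : c ≤ k) {C : Set (Submodule F (Fin n → F))} :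
    IsEquidistantCode k c C ↔ C.Nontrivial ∧ IsIntersecting k c C := by
  constructor
  · rintro ⟨⟨hk, hnt⟩, heq, hmin⟩
    refine ⟨hnt, hk, fun U hU W hW h => ?_⟩
    have h1 := heq U hU W hW h
    have h2 := Submodule.finrank_mono (inf_le_left : U ⊓ W ≤ U)
    rw [subspaceDist, hk U hU, hk W hW] at h1
    rw [hk U hU] at h2
    omega
  · rintro ⟨hnt, hC⟩
    have hd : ∀ U ∈ C, ∀ W ∈ C, U ≠ W → subspaceDist U W = 2 * k - 2 * c := fun U hU W hW h => by
      rw [subspaceDist, hC.1 U hU, hC.1 W hW, hC.2 U hU W hW h]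
      omega
    have hset : {d | ∃ U ∈ C, ∃ V ∈ C, U ≠ V ∧ subspaceDist U V = d} = {2 * k - 2 * c} := by
      ext d
      constructor
      · rintro ⟨U, hU, W, hW, h, rfl⟩
        exact hd U hU W hW h
      · rintro rfl
        obtain ⟨U, hU, W, hW, h⟩ := hnt
        exact ⟨U, hU, W, hW, h, hd U hU W hW h⟩
    have hmin : minDist C = 2 * k - 2 * c := by
      rw [minDist, hset, csInf_singleton]
    refine ⟨⟨hC.1, hnt⟩, fun U hU W hW h => (hd U hU W hW h).trans hmin.symm, ?_⟩
    rw [hmin]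
    omega

/-- Finiteness of F bounds the set of sizes, so `sSup` is not the default value 0. -/
lemma le_maxCard [Finite F] {k c : ℕ} {C : Set (Submodule F (Fin n → F))}
    (hC : IsEquidistantCode k c C) : C.ncard ≤ maxCard F k n c := by
  refine le_csSup ⟨Nat.card (Submodule F (Fin n → F)), ?_⟩ ⟨C, hC, rfl⟩
  rintro _ ⟨D, -, rfl⟩
  rw [← Set.ncard_univ]
  exact Set.ncard_le_ncard (Set.subset_univ D) Set.finite_univ

variable [Finite F]

lemma nontrivial_of_ncard_eq {C : Set (Submodule F (Fin n → F))} {m : ℕ} (hm : m ≠ 0)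
    (h : C.ncard = Nat.card F ^ m) : C.Nontrivial :=
  Set.one_lt_ncard_iff_nontrivial.1 (h ▸ Nat.one_lt_pow hm Finite.one_lt_card)

lemma IsOptimal.pow_sub_le_ncard {k c : ℕ} (hc : c < k) (hk : k < n)
    {C : Set (Submodule F (Fin n → F))} (hC : IsOptimal k c C) :
    Nat.card F ^ (n - k) ≤ C.ncard := by
  obtain ⟨hnt, hI⟩ := (isEquidistantCode_iff hc.le).1 hC.1
  obtain ⟨D, hD, hDc⟩ := exists_isIntersecting (F := F) hc hk (hI.le_of_nontrivial hnt)
  rw [hC.2, ← hDc]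
  exact le_maxCard ((isEquidistantCode_iff hc.le).2
    ⟨nontrivial_of_ncard_eq (by omega) hDc, hD⟩)

/-- The orthogonals of the graph code with parameters n - k and n + c - 2k form a competitor. -/
lemma IsOptimal.pow_le_ncard {k c : ℕ} (hc : c < k) (hk : k < n)
    {C : Set (Submodule F (Fin n → F))} (hC : IsOptimal k c C) :
    Nat.card F ^ k ≤ C.ncard := by
  obtain ⟨hnt, hI⟩ := (isEquidistantCode_iff hc.le).1 hC.1
  have hle := hI.le_of_nontrivial hnt
  obtain ⟨D, hD, hDc⟩ := exists_isIntersecting (F := F) (n := n) (k := n - k)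
    (c := n + c - 2 * k) (by omega) (by omega) (by omega)
  have hD' := hD.orthCode
  rw [show n - (n - k) = k by omega,
    show n + (n + c - 2 * k) - 2 * (n - k) = c by omega] at hD'
  rw [show n - (n - k) = k by omega] at hDc
  rw [← ncard_orthCode] at hDc
  rw [hC.2, ← hDc]
  exact le_maxCard ((isEquidistantCode_iff hc.le).2
    ⟨nontrivial_of_ncard_eq (by omega) hDc, hD'⟩)

end Optimal

/-! ### Codes with c = k - 1, and constant intersections and sums -/

section Sunflower

variable {F V : Type*} [Field F] [AddCommGroup V] [Module F V] [FiniteDimensional F V]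

/-- Spaces of dimension `k` pairwise meeting in dimension `k - 1` share their intersection, or lie
in a common space of dimension `k + 1`. -/
lemma center_or_common_sup {k : ℕ} (hk : 1 ≤ k) {C : Set (Submodule F V)}
    (hC : IsIntersecting k (k - 1) C) :
    (∃ Z, ∀ U ∈ C, ∀ W ∈ C, U ≠ W → U ⊓ W = Z) ∨
      ∃ H, ∀ U ∈ C, ∀ W ∈ C, U ≠ W → U ⊔ W = H := by
  have hsup : ∀ U ∈ C, ∀ W ∈ C, U ≠ W → finrank F ↥(U ⊔ W) = k + 1 := fun U hU W hW h => by
    have := Submodule.finrank_sup_add_finrank_inf_eq U W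
    rw [hC.2 U hU W hW h, hC.1 U hU, hC.1 W hW] at this
    omega
  by_cases hall : ∀ A ∈ C, ∀ B ∈ C, A ≠ B → ∀ U ∈ C, U ≤ A ⊔ B
  · right
    by_cases hnt : C.Nontrivial
    · obtain ⟨A, hA, B, hB, hAB⟩ := hnt
      refine ⟨A ⊔ B, fun U hU W hW h => ?_⟩
      refine Submodule.eq_of_le_of_finrank_le
        (sup_le (hall A hA B hB hAB U hU) (hall A hA B hB hAB W hW)) ?_
      rw [hsup U hU W hW h, hsup A hA B hB hAB]
    · exact ⟨⊥, fun U hU W hW h => absurd ⟨U, hU, W, hW, h⟩ hnt⟩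
  · left
    push Not at hall
    obtain ⟨A, hA, B, hB, hAB, U₀, hU₀, hU₀H⟩ := hall
    -- U meets A + B in dimension at most k - 1, already filled by U ∩ A and by U ∩ B.
    have key : ∀ U ∈ C, ¬ U ≤ A ⊔ B → U ⊓ (A ⊔ B) = A ⊓ B := by
      intro U hU hUH
      have hUA : U ≠ A := fun h => hUH (h ▸ le_sup_left)
      have hUB : U ≠ B := fun h => hUH (h ▸ le_sup_right)
      have hlt : finrank F ↥(U ⊓ (A ⊔ B)) < k := by
        rw [← hC.1 U hU]
        exact Submodule.finrank_lt_finrank_of_lt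
          (inf_le_left.lt_of_ne fun h => hUH (inf_eq_left.1 h))
      have h1 : U ⊓ A = U ⊓ (A ⊔ B) :=
        Submodule.eq_of_le_of_finrank_le (inf_le_inf_left _ le_sup_left)
          (by rw [hC.2 U hU A hA hUA]; omega)
      have h2 : U ⊓ B = U ⊓ (A ⊔ B) :=
        Submodule.eq_of_le_of_finrank_le (inf_le_inf_left _ le_sup_right)
          (by rw [hC.2 U hU B hB hUB]; omega)
      refine Submodule.eq_of_le_of_finrank_eq
        (le_inf (h1 ▸ inf_le_right) (h2 ▸ inf_le_right)) ?_
      rw [← h1, hC.2 U hU A hA hUA, hC.2 A hA B hB hAB]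
    have hle : ∀ W ∈ C, A ⊓ B ≤ W := by
      intro W hW
      by_cases hWH : W ≤ A ⊔ B
      · have hne : U₀ ≠ W := fun h => hU₀H (h ▸ hWH)
        have h1 : U₀ ⊓ W ≤ A ⊓ B := (inf_le_inf_left _ hWH).trans (key U₀ hU₀ hU₀H).le
        have h2 : U₀ ⊓ W = A ⊓ B := Submodule.eq_of_le_of_finrank_eq h1
          (by rw [hC.2 U₀ hU₀ W hW hne, hC.2 A hA B hB hAB])
        exact h2 ▸ inf_le_right
      · exact key W hW hWH ▸ inf_le_left
    refine ⟨A ⊓ B, fun U hU W hW h => ?_⟩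
    exact (Submodule.eq_of_le_of_finrank_eq (le_inf (hle U hU) (hle W hW))
      (by rw [hC.2 U hU W hW h, hC.2 A hA B hB hAB])).symm

/-- A code with constant pairwise intersections and constant pairwise sums is small. -/
lemma ncard_le_of_inf_eq_of_sup_eq [Finite F] {k c : ℕ} (hc : c < k) {C : Set (Submodule F V)}
    (hnt : C.Nontrivial) (hC : IsIntersecting k c C) {Z H : Submodule F V}
    (hZ : ∀ U ∈ C, ∀ W ∈ C, U ≠ W → U ⊓ W = Z) (hH : ∀ U ∈ C, ∀ W ∈ C, U ≠ W → U ⊔ W = H) :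
    C.ncard ≤ Nat.card F ^ (k - c) + 1 := by
  classical
  have : Finite V := Module.finite_of_finite F
  have := Fintype.ofFinite V
  have := Fintype.ofFinite F
  have hother : ∀ U ∈ C, ∃ W ∈ C, U ≠ W := fun U _ => by
    obtain ⟨W, hW, h⟩ := hnt.exists_ne U
    exact ⟨W, hW, h.symm⟩
  have hZU : ∀ U ∈ C, Z ≤ U := fun U hU => by
    obtain ⟨W, hW, h⟩ := hother U hU
    exact hZ U hU W hW h ▸ inf_le_left
  have hUH : ∀ U ∈ C, U ≤ H := fun U hU => by
    obtain ⟨W, hW, h⟩ := hother U hU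
    exact hH U hU W hW h ▸ le_sup_left
  obtain ⟨A, hA, B, hB, hAB⟩ := hnt
  have hZd : finrank F Z = c := by rw [← hZ A hA B hB hAB, hC.2 A hA B hB hAB]
  have hHd : finrank F H + c = 2 * k := by
    have := Submodule.finrank_sup_add_finrank_inf_eq A B
    rw [hC.2 A hA B hB hAB, hC.1 A hA, hC.1 B hB, hH A hA B hB hAB] at this
    omega
  let S := (Set.toFinite C).toFinset
  have hS : C.ncard = S.card := Set.ncard_eq_toFinset_card C
  have hmem : ∀ U, U ∈ S ↔ U ∈ C := fun U => Set.Finite.mem_toFinset _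
  let f : Submodule F V → Finset V := fun U => (Finset.univ.filter (· ∈ U))
  have hf : ∀ U, (f U).card = Fintype.card F ^ finrank F U := fun U => by
    rw [← natCard_submodule, Nat.card_eq_fintype_card, Fintype.card_subtype]
  have hfZ : ∀ U, Z ≤ U → (f U \ f Z).card = Fintype.card F ^ finrank F U - Fintype.card F ^ c := by
    intro U hU
    rw [Finset.card_sdiff_of_subset, hf, hf, hZd]
    intro x hx
    simp only [f, Finset.mem_filter] at hx ⊢
    exact ⟨hx.1, hU hx.2⟩
  have hdisj : (S : Set (Submodule F V)).PairwiseDisjoint fun U => f U \ f Z := by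
    intro U hU W hW h
    refine Finset.disjoint_left.2 fun x hx hx' => ?_
    simp only [f, Finset.mem_sdiff, Finset.mem_filter, Finset.mem_univ, true_and] at hx hx'
    refine hx.2 ?_
    rw [← hZ U ((hmem U).1 hU) W ((hmem W).1 hW) h]
    exact ⟨hx.1, hx'.1⟩
  have hcount : S.card * (Fintype.card F ^ k - Fintype.card F ^ c) ≤
      Fintype.card F ^ (2 * k - c) - Fintype.card F ^ c := by
    rw [show 2 * k - c = finrank F H by omega, ← hfZ H ((hZU A hA).trans (hUH A hA)),
      ← smul_eq_mul, ← Finset.sum_const, Finset.sum_congr rfl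
        (g := fun U => (f U \ f Z).card), ← Finset.card_biUnion hdisj]
    · refine Finset.card_le_card fun x hx => ?_
      obtain ⟨U, hU, hx⟩ := Finset.mem_biUnion.1 hx
      simp only [f, Finset.mem_sdiff, Finset.mem_filter, Finset.mem_univ, true_and] at hx ⊢
      exact ⟨hUH U ((hmem U).1 hU) hx.1, hx.2⟩
    · intro U hU
      rw [hfZ U (hZU U ((hmem U).1 hU)), hC.1 U ((hmem U).1 hU)]
  rw [hS, Nat.card_eq_fintype_card]
  have hq : 2 ≤ Fintype.card F := Fintype.one_lt_card
  obtain ⟨a, rfl⟩ := Nat.exists_eq_add_of_lt hc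
  rw [show 2 * (c + a + 1) - c = c + (a + 1) + (a + 1) by omega, add_assoc c a,
    pow_add _ (c + (a + 1)), pow_add _ c] at hcount
  rw [show c + a + 1 - c = a + 1 by omega]
  have hQ : 2 ≤ Fintype.card F ^ (a + 1) := hq.trans (Nat.le_self_pow (by omega) _)
  have hP : 1 ≤ Fintype.card F ^ c := Nat.one_le_pow _ _ (by omega)
  generalize Fintype.card F ^ (a + 1) = Q at *
  generalize Fintype.card F ^ c = P at *
  -- The count reads N·P(Q - 1) ≤ P(Q² - 1), whence N ≤ Q + 1.
  obtain ⟨R, rfl⟩ : ∃ R, Q = R + 1 := ⟨Q - 1, by omega⟩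
  rw [show P * (R + 1) - P = P * R by rw [mul_add, mul_one, Nat.add_sub_cancel],
    show P * (R + 1) * (R + 1) - P = P * R * (R + 1 + 1) by
      rw [show P * (R + 1) * (R + 1) = P * R * (R + 1 + 1) + P by ring,
        Nat.add_sub_cancel]] at hcount
  refine le_of_mul_le_mul_left (a := P * R) (by linarith) (Nat.mul_pos hP (by omega))

end Sunflower

/-! ### Assembling the cases -/

section Main

variable {F : Type*} [Field F] {n k c : ℕ} {C : Set (Submodule F (Fin n → F))}

lemma isSunflower_of_inf_eq (hnt : C.Nontrivial) (hC : IsIntersecting k c C)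
    {Z : Submodule F (Fin n → F)} (hZ : ∀ U ∈ C, ∀ W ∈ C, U ≠ W → U ⊓ W = Z) :
    IsSunflower k C :=
  ⟨⟨hC.1, hnt⟩, Z, hZ⟩

lemma isSunflower_of_isIntersecting_zero (hnt : C.Nontrivial) (hC : IsIntersecting k 0 C) :
    IsSunflower k C :=
  isSunflower_of_inf_eq hnt hC (Z := ⊥) fun U hU W hW h =>
    Submodule.finrank_eq_zero.1 (hC.2 U hU W hW h)

lemma orthCode_nontrivial (hnt : C.Nontrivial) : (orthCode C).Nontrivial :=
  hnt.image orth_injective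

lemma isSunflower_orthCode_of_sup_eq (hnt : C.Nontrivial) (hC : IsIntersecting k c C)
    {H : Submodule F (Fin n → F)} (hH : ∀ U ∈ C, ∀ W ∈ C, U ≠ W → U ⊔ W = H) :
    IsSunflower (n - k) (orthCode C) := by
  refine isSunflower_of_inf_eq (orthCode_nontrivial hnt) hC.orthCode (Z := orth H) ?_
  rintro _ ⟨U, hU, rfl⟩ _ ⟨W, hW, rfl⟩ h
  rw [← orth_sup, hH U hU W hW fun h' => h (congrArg orth h')]

lemma isSunflower_of_le_ncard [Fintype F] (hc : c < k) (hnt : C.Nontrivial)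
    (hC : IsIntersecting k c C) (hq : 32 ≤ Fintype.card F)
    (hcard : Fintype.card F ^ (2 * k - 1) ≤ C.ncard) : IsSunflower k C := by
  rcases c.eq_zero_or_pos with rfl | hpos
  · exact isSunflower_of_isIntersecting_zero hnt hC
  classical
  have hmem : ∀ U, U ∈ (Set.toFinite C).toFinset ↔ U ∈ C := fun U => Set.Finite.mem_toFinset _
  obtain ⟨Z, hZ⟩ := exists_center (S := (Set.toFinite C).toFinset) hpos hc
    (by rwa [Set.Finite.coe_toFinset]) (by
      rw [← Set.ncard_eq_toFinset_card C]
      refine le_trans ?_ hcard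
      rw [show 2 * k - 1 = 2 * k - 2 + 1 by omega, pow_succ']
      exact Nat.mul_le_mul_right _ (by omega))
  exact isSunflower_of_inf_eq hnt hC (Z := Z) fun U hU W hW h =>
    hZ U ((hmem U).2 hU) W ((hmem W).2 hW) h

lemma IsOptimal.eq_of_isSunflower_of_isSunflower_orthCode [Finite F] (hc : c < k) (hk : k < n)
    (hC : IsOptimal k c C) (h1 : IsSunflower k C) (h2 : IsSunflower (n - k) (orthCode C)) :
    c = 0 ∧ n = 2 * k := by
  obtain ⟨hnt, hI⟩ := (isEquidistantCode_iff hc.le).1 hC.1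
  obtain ⟨-, Z, hZ⟩ := h1
  obtain ⟨-, Y, hY⟩ := h2
  have hle := hI.le_of_nontrivial hnt
  have hup := ncard_le_of_inf_eq_of_sup_eq hc hnt hI hZ (H := orth Y) fun U hU W hW h => by
    rw [← hY _ ⟨U, hU, rfl⟩ _ ⟨W, hW, rfl⟩ fun h' => h (orth_injective h'), ← orth_sup, orth_orth]
  have hq : 2 ≤ Nat.card F := Finite.one_lt_card
  have hexp : ∀ m, Nat.card F ^ m ≤ C.ncard → m ≤ k - c := by
    intro m hm
    by_contra! hlt
    have h3 : Nat.card F ^ (k - c + 1) ≤ Nat.card F ^ m := Nat.pow_le_pow_right (by omega) hlt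
    have h4 : 2 ≤ Nat.card F ^ (k - c) := hq.trans (Nat.le_self_pow (by omega) _)
    rw [pow_succ] at h3
    nlinarith
  have := hexp _ (hC.pow_sub_le_ncard hc hk)
  have := hexp _ (hC.pow_le_ncard hc hk)
  omega

end Main

end SubspaceCodes

theorem mainTheorem1 (k n : ℕ) (hk : 1 ≤ k) (hkn : k < n) :
    ∃ q₀ : ℕ, ∀ (q : ℕ) (F : Type*) [Field F] [Fintype F], Fintype.card F = q →
      ∀ c : ℕ, c ≤ k - 1 → ∀ C : Set (Submodule F (Fin n → F)),
        SubspaceCodes.IsOptimal k c C →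
        ((c = 0 ∨ c = k - 1 ∨ (c : ℤ) = 2 * (k : ℤ) - (n : ℤ)) ∨
          ((n : ℚ) ≤ (3 * (k : ℚ) + 1) / 2 ∧ q₀ ≤ q) ∨
          (3 * k + 1 ≤ n ∧ q₀ ≤ q)) →
        (SubspaceCodes.IsSunflower k C ∨
          SubspaceCodes.IsSunflower (n - k) (SubspaceCodes.orthCode C)) ∧
        ((SubspaceCodes.IsSunflower k C ∧
            SubspaceCodes.IsSunflower (n - k) (SubspaceCodes.orthCode C)) ↔
          (c = 0 ∧ n = 2 * k)) := by
  open SubspaceCodes in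
  -- Any constant from 17 on would do: it absorbs the 17 of `exists_center` into one factor q.
  refine ⟨32, fun q F _ _ hFq c hc C hC hcond => ?_⟩
  have hck : c < k := by omega
  obtain ⟨hnt, hI⟩ := (isEquidistantCode_iff hck.le).1 hC.1
  have hle := hI.le_of_nontrivial hnt
  have hcard := hC.pow_sub_le_ncard hck hkn
  have hcard' := hC.pow_le_ncard hck hkn
  rw [Nat.card_eq_fintype_card] at hcard hcard'
  have hdual : n + c = 2 * k → IsSunflower (n - k) (orthCode C) := fun h => by
    have hI' := hI.orthCode
    rw [show n + c - 2 * k = 0 by omega] at hI'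
    exact isSunflower_of_isIntersecting_zero (orthCode_nontrivial hnt) hI'
  constructor
  · rcases hcond with (rfl | rfl | h) | ⟨h, hq⟩ | ⟨h, hq⟩
    · exact Or.inl (isSunflower_of_isIntersecting_zero hnt hI)
    · rcases center_or_common_sup hk hI with ⟨Z, hZ⟩ | ⟨H, hH⟩
      · exact Or.inl (isSunflower_of_inf_eq hnt hI hZ)
      · exact Or.inr (isSunflower_orthCode_of_sup_eq hnt hI hH)
    · exact Or.inr (hdual (by omega))
    · right
      have hn : 2 * n ≤ 3 * k + 1 := by
        rw [le_div_iff₀ (by norm_num)] at h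
        have : (n : ℚ) * 2 = ((n * 2 : ℕ) : ℚ) := by push_cast; ring
        rw [this] at h
        have h' : n * 2 ≤ 3 * k + 1 := by exact_mod_cast h
        omega
      -- For the dual code the required exponent is 2(n-k) - 1, and it is at most k exactly when 2n
      -- ≤ 3k + 1.
      refine isSunflower_of_le_ncard (by omega) (orthCode_nontrivial hnt) hI.orthCode
        (hFq ▸ hq) ?_
      rw [ncard_orthCode]
      exact (Nat.pow_le_pow_right Fintype.card_pos (by omega)).trans hcard'
    · left
      exact isSunflower_of_le_ncard hck hnt hI (hFq ▸ hq)
        ((Nat.pow_le_pow_right Fintype.card_pos (by omega)).trans hcard)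
  · constructor
    · rintro ⟨h1, h2⟩
      exact hC.eq_of_isSunflower_of_isSunflower_orthCode hck hkn h1 h2
    · rintro ⟨rfl, hn⟩
      exact ⟨isSunflower_of_isIntersecting_zero hnt hI, hdual (by omega)⟩
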